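/- Let $\mathbb F$ be a finite field with algebraic closure $\bar{\mathbb F}$, and let $n,k,\delta$ be positive integers with $k<n$. For a field $K$, a system $(A,B,C,D)$ with $A\in K^{\delta\times\delta}$, $B\in K^{\delta\times k}$, $C\in K^{(n-k)\times\delta}$, $D\in K^{(n-k)\times k}$ generates the convolutional code consisting of all sequences $v_t=\binom{y_t}{u_t}\in K^n$, $t=0,1,2,\dots$, for which there are states $x_t\in K^\delta$ with $x_0=0$, $x_{t+1}=Ax_t+Bu_t$ and $y_t=Cx_t+Du_t$ for all $t\ge 0$. If $(A,B)$ is controllable and $(A,C)$ is observable, i.e. the matrices with block columns $B,AB,\dots,A^{\delta-1}B$ and with block rows $C,CA,\dots,CA^{\delta-1}$ both have rank $\delta$, this code is called an $(n,k,\delta)$-code. Its $j$th column distance is $$d_j=\min\Big\{\sum_{t=0}^{j}\mathrm{wt}(v_t)\Big\},$$ the minimum being over all code sequences with $u_0\neq 0$, where $\mathrm{wt}$ is the number of nonzero components. An $(n,k,\delta)$-code has a maximum distance profile (is an MDP code) if $$d_j=(n-k)(j+1)+1\quad\text{for } j=0,1,\dots,L,\qquad L=\Big\lfloor\frac{\delta}{k}\Big\rfloor+\Big\lfloor\frac{\delta}{n-k}\Big\rfloor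 .$$ Theorem. (1) There is a maximum distance profile $(n,k,\delta)$ convolutional code over some finite extension field of $\mathbb F$. (2) The set of all $(A,B,C,D)$ over $\bar{\mathbb F}$ that represent a maximum distance profile $(n,k,\delta)$ convolutional code (controllability and observability included) is a generic set in the affine space $\bar{\mathbb F}^{(\delta+n-k)(\delta+k)}$ of all such tuples of matrices: it is nonempty, Zariski open and Zariski dense. -/

import Mathlib

open scoped Matrix

/-- A linear system `(A, B, C, D)` over `K` with `δ` states, `k` inputs and `n - k` outputs:
`x (t+1) = A x t + B u t`, `y t = C x t + D u t`. -/
structure LinSys (K : Type*) (n k δ : ℕ) where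
  A : Matrix (Fin δ) (Fin δ) K
  B : Matrix (Fin δ) (Fin k) K
  C : Matrix (Fin (n - k)) (Fin δ) K
  D : Matrix (Fin (n - k)) (Fin k) K

/-- Sequences of code vectors `v t = (y t, u t)` of length `n = (n - k) + k`:
the left summand indexes the parity part `y t`, the right summand the information part `u t`. -/
abbrev CodeSeq (K : Type*) (n k : ℕ) : Type _ := ℕ → (Fin (n - k) ⊕ Fin k → K)

/-- The parity vector `y t` of a code sequence. -/
def CodeSeq.parity {K : Type*} {n k : ℕ} (v : CodeSeq K n k) (t : ℕ) : Fin (n - k) → K :=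
  fun i => v t (Sum.inl i)

/-- The information vector `u t` of a code sequence. -/
def CodeSeq.info {K : Type*} {n k : ℕ} (v : CodeSeq K n k) (t : ℕ) : Fin k → K :=
  fun i => v t (Sum.inr i)

open Classical in
/-- The `j`-th column distance of a set `𝒞` of code sequences: the minimum of
`wt (v 0) + ... + wt (v j)` over all `v ∈ 𝒞` whose information vector at time `0` is nonzero.
(For the code of a system with `0 < k` this is a minimum over a nonempty set of naturals.) -/
noncomputable def columnDistance {K : Type*} [Field K] {n k : ℕ}
    (𝒞 : Set (CodeSeq K n k)) (j : ℕ) : ℕ :=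
  sInf {d : ℕ | ∃ v ∈ 𝒞, v.info 0 ≠ 0 ∧ d = ∑ t ∈ Finset.range (j + 1), hammingNorm (v t)}

/-- `d_j = (n - k)(j + 1) + 1` for `j = 0, ..., L`, where `L = ⌊δ / k⌋ + ⌊δ / (n - k)⌋`. -/
def HasMaximumDistanceProfile {K : Type*} [Field K] {n k : ℕ}
    (𝒞 : Set (CodeSeq K n k)) (δ : ℕ) : Prop :=
  ∀ j ≤ δ / k + δ / (n - k), columnDistance 𝒞 j = (n - k) * (j + 1) + 1

namespace LinSys

variable {K : Type*} {n k δ : ℕ}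

/-- The convolutional code generated by `(A, B, C, D)`: all code vector sequences of the system
started at the state `x 0 = 0`. -/
def code [Field K] (S : LinSys K n k δ) : Set (CodeSeq K n k) :=
  {v | ∃ x : ℕ → Fin δ → K, x 0 = 0 ∧
    (∀ t, x (t + 1) = S.A *ᵥ x t + S.B *ᵥ v.info t) ∧
    ∀ t, v.parity t = S.C *ᵥ x t + S.D *ᵥ v.info t}

/-- `(A, B)` is a controllable pair: `[B, AB, ..., A^(δ-1) B]` has rank `δ`. -/
def IsControllable [Field K] (S : LinSys K n k δ) : Prop :=
  (Matrix.of fun (i : Fin δ) (c : Fin δ × Fin k) => (S.A ^ (c.1 : ℕ) * S.B) i c.2).rank = δ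

/-- `(A, C)` is an observable pair: the matrix with block rows `C, CA, ..., C A^(δ-1)`
has rank `δ`. -/
def IsObservable [Field K] (S : LinSys K n k δ) : Prop :=
  (Matrix.of fun (r : Fin δ × Fin (n - k)) (i : Fin δ) => (S.C * S.A ^ (r.1 : ℕ)) r.2 i).rank = δ

/-- `(A, B, C, D)` represents a maximum distance profile `(n, k, δ)` convolutional code. -/
def IsMDP [Field K] (S : LinSys K n k δ) : Prop :=
  S.IsControllable ∧ S.IsObservable ∧ HasMaximumDistanceProfile S.code δ

/-- The point of affine space of dimension `(δ + (n - k)) (δ + k)` whose coordinates are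
the entries of the block matrix with rows `(A, B)` and `(C, D)`. -/
def toAffine (S : LinSys K n k δ) :
    (Fin δ ⊕ Fin (n - k)) × (Fin δ ⊕ Fin k) → K :=
  fun p => Matrix.fromBlocks S.A S.B S.C S.D p.1 p.2

end LinSys

/-- Zariski closed subsets of the affine space `σ → K`: the zero sets of polynomial ideals. -/
def IsZariskiClosed {σ K : Type*} [Field K] (Z : Set (σ → K)) : Prop :=
  ∃ I : Ideal (MvPolynomial σ K), Z = MvPolynomial.zeroLocus K I

/-- A generic subset of the affine space `σ → K`: nonempty, Zariski open and Zariski dense. -/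
def IsGeneric {σ K : Type*} [Field K] (U : Set (σ → K)) : Prop :=
  U.Nonempty ∧ IsZariskiClosed Uᶜ ∧
    ∀ Z : Set (σ → K), IsZariskiClosed Z → U ⊆ Z → Z = Set.univ

/-! ### Block lower triangular Toeplitz matrices and their minors -/

/-! With zero initial state the code is the graph of convolution by the Markov parameters `D, CB,
CAB, ...`, so its column distances depend only on their block Toeplitz matrices. Maximality of the
profile up to `L` is equivalent to nonvanishing of every minor that the block triangular shape does
not force to vanish (`hasMaximumDistanceProfile_iff_isSuperregular`). Controllability and
observability are also nonvanishing of some maximal minor. The MDP systems are thus the nonvanishing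
locus of finitely many polynomials, each a product of minors. Polynomials over a field form a
domain, so it is enough that each factor is nonzero, and each factor may use its own system. For the
rank conditions a shift works. For a Toeplitz minor, monomial blocks with exponents convex in the
position make all admissible minors nonzero. Their values need not come from `δ` states, but a
truncation does: if one Hankel minor, itself an admissible Toeplitz minor, is nonzero, a Ho–Kalman
construction realizes exactly the first `δ/k + δ/(n-k)` blocks after `D`
(`exists_partial_realization`). A point over the algebraic closure has finitely many algebraic
coordinates, hence lives over a finite extension. -/

/-- The block lower triangular Toeplitz matrix with `j + 1` block rows and blocks `F 0, ..., F j`. -/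
def blockToeplitz {R : Type*} [Zero R] {p m : ℕ} (F : ℕ → Matrix (Fin p) (Fin m) R) (j : ℕ) :
    Matrix (Fin (j + 1) ×ₗ Fin p) (Fin (j + 1) ×ₗ Fin m) R :=
  Matrix.of fun r c =>
    if (ofLex c).1 ≤ (ofLex r).1 then
      F ((ofLex r).1 - (ofLex c).1 : ℕ) (ofLex r).2 (ofLex c).2 else 0

/-- Increasing row and column selections whose diagonal lies in the block lower triangle. -/
structure IsAdmissible {p m j w : ℕ} (f : Fin w → Fin (j + 1) ×ₗ Fin p)
    (g : Fin w → Fin (j + 1) ×ₗ Fin m) : Prop where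
  row : StrictMono f
  col : StrictMono g
  le : ∀ s, (ofLex (g s)).1 ≤ (ofLex (f s)).1

/-- All minors of the block Toeplitz matrices up to order `L` that are not forced to vanish by
the triangular shape are nonzero. -/
def IsSuperregular {R : Type*} [CommRing R] {p m : ℕ} (F : ℕ → Matrix (Fin p) (Fin m) R)
    (L : ℕ) : Prop :=
  ∀ j ≤ L, ∀ (w : ℕ) (f : Fin w → Fin (j + 1) ×ₗ Fin p) (g : Fin w → Fin (j + 1) ×ₗ Fin m),
    IsAdmissible f g → ((blockToeplitz F j).submatrix f g).det ≠ 0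

/-- The convolution `∑ s ≤ t, F (t - s) u s`. -/
def blockConv {R : Type*} [CommRing R] {p m : ℕ} (F : ℕ → Matrix (Fin p) (Fin m) R)
    (u : ℕ → Fin m → R) (t : ℕ) : Fin p → R :=
  ∑ s ∈ Finset.range (t + 1), F (t - s) *ᵥ u s

section Superregular

open Finset

variable {K : Type*} [Field K] {p m : ℕ}

-- If there were as many zero outputs as support columns, pair them in increasing order and cut at
-- the first pair lying above the block diagonal. Rows before the cut have zero entries in the
-- columns after it, so the leading admissible minor would annihilate a nonzero part of `u`.
open Classical in
theorem card_zeros_lt_card_support {j : ℕ} (F : ℕ → Matrix (Fin p) (Fin m) K)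
    (h : ∀ (w : ℕ) (f : Fin w → Fin (j + 1) ×ₗ Fin p) (g : Fin w → Fin (j + 1) ×ₗ Fin m),
      IsAdmissible f g → ((blockToeplitz F j).submatrix f g).det ≠ 0)
    (u : Fin (j + 1) ×ₗ Fin m → K) (c₀ : Fin (j + 1) ×ₗ Fin m) (hc₀ : (ofLex c₀).1 = 0)
    (hu : u c₀ ≠ 0) :
    #{r | (blockToeplitz F j *ᵥ u) r = 0} < #{c | u c ≠ 0} := by
  by_contra! hcon
  obtain ⟨Z, hZ, hZc⟩ := exists_subset_card_eq hcon
  set J : Finset (Fin (j + 1) ×ₗ Fin m) := {c | u c ≠ 0} with hJ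
  set w := #J with hw
  set g := J.orderEmbOfFin hw.symm
  set f := Z.orderEmbOfFin hZc
  have hgJ : ∀ s, u (g s) ≠ 0 := fun s => by
    have := J.orderEmbOfFin_mem hw.symm s
    exact (mem_filter.1 this).2
  have hfZ : ∀ s, (blockToeplitz F j *ᵥ u) (f s) = 0 := fun s => by
    have := hZ (Z.orderEmbOfFin_mem hZc s)
    simpa using this
  have hgr : ∀ c, u c ≠ 0 → ∃ s, g s = c := fun c hc => by
    have : c ∈ Set.range g := by
      rw [J.range_orderEmbOfFin hw.symm]; simpa [hJ] using hc
    exact this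
  -- `q` is the first pair that violates admissibility, or `w` if none does.
  have hex : ∃ q, q = w ∨ ∃ h : q < w, ¬ (ofLex (g ⟨q, h⟩)).1 ≤ (ofLex (f ⟨q, h⟩)).1 :=
    ⟨w, .inl rfl⟩
  set q := Nat.find hex
  have hqw : q ≤ w := Nat.find_min' hex (.inl rfl)
  have hlt : ∀ s : Fin w, s < q → (ofLex (g s)).1 ≤ (ofLex (f s)).1 := fun s hs => by
    by_contra hn
    exact Nat.find_min hex hs (.inr ⟨s.2, hn⟩)
  have hmonof : ∀ s s' : Fin w, s ≤ s' → (ofLex (f s)).1 ≤ (ofLex (f s')).1 := fun s s' hs =>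
    Prod.Lex.monotone_fst _ _ (f.monotone hs)
  have hmonog : ∀ s s' : Fin w, s ≤ s' → (ofLex (g s)).1 ≤ (ofLex (g s')).1 := fun s s' hs =>
    Prod.Lex.monotone_fst _ _ (g.monotone hs)
  have hge : ∀ s s' : Fin w, s < q → q ≤ s' → (ofLex (f s)).1 < (ofLex (g s')).1 := by
    intro s s' hs hs'
    rcases Nat.find_spec hex with h1 | ⟨h1, h2⟩
    · have := s'.2; omega
    · exact (hmonof s ⟨q, h1⟩ (Fin.le_def.2 hs.le)).trans_lt
        ((not_le.1 h2).trans_le (hmonog ⟨q, h1⟩ s' hs'))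
  obtain ⟨s₀, hs₀⟩ := hgr c₀ hu
  -- The support meets block column 0, so the first selected column lies there and the first pair is
  -- never a violation.
  have hq0 : 0 < q := by
    by_contra hq
    have hq : q = 0 := by omega
    rcases Nat.find_spec hex with h1 | ⟨h1, h2⟩
    · have := s₀.2; omega
    · apply h2
      have := hmonog ⟨q, h1⟩ s₀ (Fin.le_def.2 (by change q ≤ _; omega))
      rw [hs₀, hc₀] at this
      exact this.trans (Fin.zero_le _)
  have hadm : IsAdmissible (f ∘ Fin.castLE hqw) (g ∘ Fin.castLE hqw) :=
    ⟨f.strictMono.comp (Fin.strictMono_castLE hqw), g.strictMono.comp (Fin.strictMono_castLE hqw),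
      fun s => hlt _ s.2⟩
  have hz := Matrix.eq_zero_of_mulVec_eq_zero (h q _ _ hadm)
    (v := fun s => u (g (Fin.castLE hqw s))) (by
      ext s
      rw [Pi.zero_apply, ← hfZ (Fin.castLE hqw s)]
      simp only [Matrix.mulVec, dotProduct, Matrix.submatrix_apply]
      refine Fintype.sum_of_injective (g ∘ Fin.castLE hqw)
        (g.injective.comp (Fin.castLE_injective hqw)) _ _ ?_ fun _ => rfl
      intro c hc
      by_cases huc : u c = 0
      · simp [huc]
      · obtain ⟨s', rfl⟩ := hgr c huc
        have hs' : q ≤ s' := by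
          by_contra hn
          exact hc ⟨⟨s', not_le.1 hn⟩, rfl⟩
        have := hge (Fin.castLE hqw s) s' s.2 hs'
        simp [blockToeplitz, not_le.2 this])
  exact hgJ _ (congrFun hz ⟨0, hq0⟩)

open Classical in
theorem sum_hammingNorm_range (v : ℕ → Fin p → K) (j : ℕ) :
    ∑ t ∈ range (j + 1), hammingNorm (v t) =
      #{r : Fin (j + 1) ×ₗ Fin p | v (ofLex r).1 (ofLex r).2 ≠ 0} := by
  rw [card_filter, ← Equiv.sum_comp toLex, Fintype.sum_prod_type, sum_range]
  refine sum_congr rfl fun t _ => ?_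
  simp only [hammingNorm, card_filter, ofLex_toLex]
  refine sum_congr rfl fun i _ => ?_
  congr

theorem blockToeplitz_mulVec (F : ℕ → Matrix (Fin p) (Fin m) K) (u : ℕ → Fin m → K) (j : ℕ)
    (r : Fin (j + 1) ×ₗ Fin p) :
    (blockToeplitz F j *ᵥ fun c => u (ofLex c).1 (ofLex c).2) r =
      blockConv F u (ofLex r).1 (ofLex r).2 := by
  obtain ⟨⟨t, i⟩, rfl⟩ := toLex.surjective r
  simp only [Matrix.mulVec, dotProduct, blockConv, ofLex_toLex, Finset.sum_apply]
  rw [← Equiv.sum_comp toLex, Fintype.sum_prod_type]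
  have h1 : ∀ s : Fin (j + 1),
      (∑ b, blockToeplitz F j (toLex (t, i)) (toLex (s, b)) * u s b) =
      if (s : ℕ) ≤ t then ∑ b, F (t - s) i b * u s b else 0 := fun s => by
    by_cases h : s ≤ t
    · simp [blockToeplitz, h]
    · simp [blockToeplitz, h]
  refine (sum_congr rfl fun s _ => h1 s).trans ?_
  rw [← sum_range (fun s => if s ≤ (t : ℕ) then ∑ b, F (t - s) i b * u s b else 0), ← sum_filter]
  refine sum_congr ?_ fun _ _ => rfl
  ext s
  have := t.2
  simp; omega

open Classical in
theorem IsSuperregular.le_weight {F : ℕ → Matrix (Fin p) (Fin m) K} {L j : ℕ}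
    (h : IsSuperregular F L) (hj : j ≤ L) (u : ℕ → Fin m → K) (hu : u 0 ≠ 0) :
    p * (j + 1) + 1 ≤
      ∑ t ∈ range (j + 1), (hammingNorm (blockConv F u t) + hammingNorm (u t)) := by
  obtain ⟨b, hb⟩ := Function.ne_iff.1 hu
  have key := card_zeros_lt_card_support F (h j hj) (fun c => u (ofLex c).1 (ofLex c).2)
    (toLex (0, b)) rfl (by simpa using hb)
  simp only [blockToeplitz_mulVec] at key
  rw [sum_add_distrib, sum_hammingNorm_range, sum_hammingNorm_range]
  have := card_filter_add_card_filter_not (s := univ)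
    (fun r : Fin (j + 1) ×ₗ Fin p => blockConv F u (ofLex r).1 (ofLex r).2 = 0)
  have hc : #(univ : Finset (Fin (j + 1) ×ₗ Fin p)) = p * (j + 1) := by
    rw [card_univ, Fintype.card_lex, Fintype.card_prod, Fintype.card_fin, Fintype.card_fin,
      mul_comm]
  rw [hc] at this
  simp only [ne_eq] at *
  omega

-- A kernel vector of a singular admissible minor, shifted in time so that its first nonzero entry
-- sits at time 0, is an input whose weight is at most the number of output zeros it forces.
-- Admissibility keeps those zero rows inside the shifted window.
open Classical in
theorem isSuperregular_of_le_weight {F : ℕ → Matrix (Fin p) (Fin m) K} {L : ℕ}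
    (h : ∀ j ≤ L, ∀ u : ℕ → Fin m → K, u 0 ≠ 0 → p * (j + 1) + 1 ≤
      ∑ t ∈ range (j + 1), (hammingNorm (blockConv F u t) + hammingNorm (u t))) :
    IsSuperregular F L := by
  intro j hj w f g hfg hdet
  obtain ⟨v, hv0, hv⟩ := Matrix.exists_mulVec_eq_zero_iff.2 hdet
  have hex : ∃ q : ℕ, ∃ h : q < w, v ⟨q, h⟩ ≠ 0 := by
    obtain ⟨s, hs⟩ := Function.ne_iff.1 hv0
    exact ⟨s, s.2, hs⟩
  obtain ⟨hq, hvq⟩ := Nat.find_spec hex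
  set q := Nat.find hex
  have hmin : ∀ s : Fin w, v s ≠ 0 → q ≤ s := fun s hs => Nat.find_min' hex ⟨s.2, hs⟩
  set j₀ : ℕ := Fin.val (ofLex (g ⟨q, hq⟩)).1 with hj₀
  have hmonog : ∀ s s' : Fin w, s ≤ s' → (ofLex (g s)).1 ≤ (ofLex (g s')).1 := fun s s' hs =>
    Prod.Lex.monotone_fst _ _ (hfg.col.monotone hs)
  have hg₀ : ∀ s : Fin w, q ≤ s → j₀ ≤ (ofLex (g s)).1 := fun s hs =>
    Fin.le_def.1 (hmonog ⟨q, hq⟩ s (Fin.le_def.2 hs))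
  have hf₀ : ∀ s : Fin w, q ≤ s → j₀ ≤ (ofLex (f s)).1 := fun s hs =>
    (hg₀ s hs).trans (Fin.le_def.1 (hfg.le s))
  have hj₀j : j₀ ≤ j := Nat.le_of_lt_succ (ofLex (g ⟨q, hq⟩)).1.2
  -- The kernel vector spread over its columns, with block `j₀` moved to time 0.
  set u : ℕ → Fin m → K := fun t b =>
    ∑ s, if ((ofLex (g s)).1 : ℕ) = t + j₀ ∧ (ofLex (g s)).2 = b then v s else 0 with hu
  have hug : ∀ s : Fin w, q ≤ s → u ((ofLex (g s)).1 - j₀) (ofLex (g s)).2 = v s := by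
    intro s hs
    rw [hu]
    dsimp only
    rw [sum_eq_single s]
    · rw [if_pos ⟨by have := hg₀ s hs; omega, rfl⟩]
    · intro s' _ hne
      rw [if_neg]
      rintro ⟨h1, h2⟩
      apply hne
      apply hfg.col.injective
      apply ofLex.injective
      refine Prod.ext (Fin.ext ?_) h2
      have := hg₀ s hs; omega
    · simp
  have hu0 : u 0 ≠ 0 := by
    intro h0
    have := hug ⟨q, hq⟩ le_rfl
    rw [← hj₀, Nat.sub_self, h0] at this
    exact hvq this.symm
  have hconv : ∀ (τ : ℕ) (a : Fin p), τ + j₀ ≤ j → blockConv F u τ a =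
      ∑ s, if ((ofLex (g s)).1 : ℕ) ≤ τ + j₀ then
        F (τ + j₀ - (ofLex (g s)).1) a (ofLex (g s)).2 * v s else 0 := by
    intro τ a _
    simp only [blockConv, Finset.sum_apply, Matrix.mulVec, dotProduct, hu, mul_sum]
    rw [sum_congr rfl fun t _ => sum_comm, sum_comm]
    refine sum_congr rfl fun s _ => ?_
    by_cases hvs : v s = 0
    · simp [hvs]
    have hs := hg₀ s (hmin s hvs)
    have h1 : ∀ t, (∑ b, F (τ - t) a b * if ((ofLex (g s)).1 : ℕ) = t + j₀ ∧ (ofLex (g s)).2 = b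
        then v s else 0) = if t = ((ofLex (g s)).1 : ℕ) - j₀ then
          F (τ - t) a (ofLex (g s)).2 * v s else 0 := by
      intro t
      by_cases ht : t = ((ofLex (g s)).1 : ℕ) - j₀
      · have ht' : ((ofLex (g s)).1 : ℕ) = t + j₀ := by omega
        simp [ht, Nat.sub_add_cancel hs]
      · have ht' : ¬ ((ofLex (g s)).1 : ℕ) = t + j₀ := by omega
        simp [ht, ht']
    rw [sum_congr rfl fun t _ => h1 t, sum_ite_eq']
    have h2 : ((ofLex (g s)).1 : ℕ) - j₀ ∈ range (τ + 1) ↔ ((ofLex (g s)).1 : ℕ) ≤ τ + j₀ := by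
      rw [mem_range]; omega
    simp only [h2]
    congr 3
    omega
  have hzero : ∀ s : Fin w, q ≤ s →
      blockConv F u ((ofLex (f s)).1 - j₀) (ofLex (f s)).2 = 0 := by
    intro s hs
    have h1 := hf₀ s hs
    have h2 := (ofLex (f s)).1.2
    have h3 := congrFun hv s
    simp only [Matrix.mulVec, dotProduct, Matrix.submatrix_apply, blockToeplitz, Matrix.of_apply,
      ite_mul, zero_mul, Fin.le_def, Pi.zero_apply] at h3
    rw [hconv _ _ (by omega), Nat.sub_add_cancel h1, h3]
  have hS : #{s : Fin w | q ≤ s} = w - q := by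
    have : ({s : Fin w | q ≤ s} : Finset (Fin w)) = Finset.Ici ⟨q, hq⟩ := by
      ext s; simp [Fin.le_def]
    rw [this, Fin.card_Ici]
  have hsupp : #{c : Fin (j - j₀ + 1) ×ₗ Fin m | u (ofLex c).1 (ofLex c).2 ≠ 0} ≤ w - q := by
    rw [← hS]
    refine card_le_card_of_surjOn
      (fun s => toLex (Fin.ofNat (j - j₀ + 1) ((ofLex (g s)).1 - j₀), (ofLex (g s)).2)) ?_
    intro c hc
    simp only [coe_filter, mem_univ, true_and, Set.mem_ofPred_eq, hu] at hc
    obtain ⟨s, _, hs⟩ := exists_ne_zero_of_sum_ne_zero hc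
    simp only [ne_eq, ite_eq_right_iff, Classical.not_imp] at hs
    refine ⟨s, by simpa using hmin s hs.2, ?_⟩
    apply ofLex.injective
    refine Prod.ext (Fin.ext ?_) hs.1.2
    have := (ofLex c).1.2
    simp only [ofLex_toLex, Fin.val_ofNat, hs.1.1, Nat.add_sub_cancel]
    exact Nat.mod_eq_of_lt this
  have hzeros : w - q ≤ #{r : Fin (j - j₀ + 1) ×ₗ Fin p |
      blockConv F u (ofLex r).1 (ofLex r).2 = 0} := by
    rw [← hS]
    have hmod : ∀ s : Fin w, q ≤ s → ((ofLex (f s)).1 - j₀ : ℕ) % (j - j₀ + 1) =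
        (ofLex (f s)).1 - j₀ := fun s hs => by
      have := (ofLex (f s)).1.2
      exact Nat.mod_eq_of_lt (by omega)
    refine card_le_card_of_injOn
      (fun s => toLex (Fin.ofNat (j - j₀ + 1) ((ofLex (f s)).1 - j₀), (ofLex (f s)).2)) ?_ ?_
    · intro s hs
      simp only [coe_filter, mem_univ, true_and, Set.mem_ofPred_eq] at hs
      simp [hmod s hs, hzero s hs]
    · intro s hs s' hs' he
      simp only [coe_filter, mem_univ, true_and, Set.mem_ofPred_eq] at hs hs'
      have he := toLex.injective he
      have h1 := congrArg (fun x => (x.1 : ℕ)) he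
      have h2 := congrArg Prod.snd he
      simp only [Fin.val_ofNat, hmod s hs, hmod s' hs'] at h1 h2
      apply hfg.row.injective
      apply ofLex.injective
      refine Prod.ext (Fin.ext ?_) h2
      have := hf₀ s hs; have := hf₀ s' hs'; omega
  have := h (j - j₀) (by omega) u hu0
  rw [sum_add_distrib, sum_hammingNorm_range, sum_hammingNorm_range] at this
  have h3 := card_filter_add_card_filter_not (s := univ)
    (fun r : Fin (j - j₀ + 1) ×ₗ Fin p => blockConv F u (ofLex r).1 (ofLex r).2 = 0)
  have hc : #(univ : Finset (Fin (j - j₀ + 1) ×ₗ Fin p)) = p * (j - j₀ + 1) := by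
    rw [card_univ, Fintype.card_lex, Fintype.card_prod, Fintype.card_fin, Fintype.card_fin,
      mul_comm]
  rw [hc] at h3
  simp only [ne_eq] at *
  omega

end Superregular

/-! ### A block Toeplitz matrix of monomials with nonvanishing admissible minors -/

section Monomial

open Finset Polynomial

variable {K : Type*} [Field K] {p m : ℕ}

/-- In the Leibniz expansion only the identity contributes in degree `∑ i, e i i`: any other
permutation meets a zero entry or has larger degree. -/
theorem det_monomials_ne_zero {w : ℕ} (z : Fin w → Fin w → Prop) [DecidableRel z]
    (e : Fin w → Fin w → ℕ) (hz : ∀ i, z i i)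
    (he : ∀ σ : Equiv.Perm (Fin w), σ ≠ 1 → (∀ i, z (σ i) i) → ∑ i, e i i < ∑ i, e (σ i) i) :
    (Matrix.of fun i j => if z i j then (X : K[X]) ^ e i j else 0).det ≠ 0 := by
  intro h0
  have h1 := congrArg (fun q => q.coeff (∑ i, e i i)) h0
  simp only [Matrix.det_apply, Matrix.of_apply, finsetSum_coeff, coeff_zero] at h1
  rw [sum_eq_single 1] at h1
  · simp [hz, prod_pow_eq_pow_sum] at h1
  · intro σ _ hσ
    by_cases hzσ : ∀ i, z (σ i) i
    · simp only [hzσ, if_true, prod_pow_eq_pow_sum]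
      have := (he σ hσ hzσ).ne
      rw [Units.smul_def, coeff_smul, coeff_X_pow, if_neg this, smul_zero]
    · obtain ⟨i, hi⟩ := not_forall.1 hzσ
      rw [prod_eq_zero (mem_univ i) (if_neg hi)]
      simp
  · simp

/-- The strict rearrangement inequality; equality would make `σ` monotone, hence the identity. -/
theorem sum_sq_sub_lt_of_strictMono {w : ℕ} {x y : Fin w → ℤ} (hx : StrictMono x)
    (hy : StrictMono y) {σ : Equiv.Perm (Fin w)} (hσ : σ ≠ 1) :
    ∑ i, (x i - y i) ^ 2 < ∑ i, (x (σ i) - y i) ^ 2 := by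
  have h1 : ∑ i, x (σ i) * y i < ∑ i, x i * y i := by
    rw [(hx.monotone.monovary hy.monotone).sum_comp_perm_mul_lt_sum_mul_iff]
    intro hmv
    apply hσ
    have hmono : StrictMono σ := by
      refine Monotone.strictMono_of_injective (fun i j hij => ?_) σ.injective
      rcases hij.eq_or_lt with rfl | hij
      · rfl
      · exact hx.le_iff_le.1 (hmv (hy hij))
    ext i
    exact congrArg Fin.val (congrArg (fun e : Fin w ≃o Fin w => e i)
      (Subsingleton.elim (hmono.orderIsoOfSurjective σ σ.surjective) (OrderIso.refl _)))
  have h2 : ∑ i, x (σ i) ^ 2 = ∑ i, x i ^ 2 := Equiv.sum_comp σ fun i => x i ^ 2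
  simp only [sub_sq, sum_add_distrib, sum_sub_distrib, mul_assoc, ← mul_sum, h2]
  linarith

/-- Blocks of monomials whose exponents are a strictly convex function of the position. -/
noncomputable def monomialBlocks (K : Type*) [Field K] (p m d : ℕ) :
    Matrix (Fin p) (Fin m) K[X] :=
  Matrix.of fun a b => X ^ ((p + m) * d + a + (m - b)) ^ 2

/-- Entry exponents are `(x - y) ^ 2` with `x = (p + m) t + a + m` for row `(t, a)` and `y = (p + m)
s + b` for column `(s, b)`. The factor `p + m` exceeds every offset within a block, so both increase
lexicographically and the diagonal is the unique minimum. -/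
theorem det_blockToeplitz_monomialBlocks_ne_zero {j w : ℕ} {f : Fin w → Fin (j + 1) ×ₗ Fin p}
    {g : Fin w → Fin (j + 1) ×ₗ Fin m} (h : IsAdmissible f g) :
    ((blockToeplitz (monomialBlocks K p m) j).submatrix f g).det ≠ 0 := by
  have hstep : ∀ {P : ℕ} (r r' : Fin (j + 1) ×ₗ Fin P), P ≤ p + m → r < r' →
      ((p + m) * (ofLex r).1 + (ofLex r).2 : ℤ) < (p + m) * (ofLex r').1 + (ofLex r').2 := by
    intro P r r' hP hr
    rcases Prod.Lex.lt_iff.1 hr with h1 | ⟨h1, h2⟩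
    · have h3 : ((ofLex r).1 + 1 : ℤ) ≤ (ofLex r').1 := by exact_mod_cast Fin.lt_def.1 h1
      have h4 : ((ofLex r).2 : ℤ) < p + m := by
        exact_mod_cast (ofLex r).2.2.trans_le hP
      have h5 : (0 : ℤ) ≤ (ofLex r').2 := by positivity
      have h6 : (0 : ℤ) ≤ p + m := by positivity
      nlinarith
    · rw [h1]
      have : ((ofLex r).2 : ℤ) < (ofLex r').2 := by exact_mod_cast Fin.lt_def.1 h2
      linarith
  have hx : StrictMono fun s => ((p + m) * (ofLex (f s)).1 + (ofLex (f s)).2 + m : ℤ) :=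
    fun s s' hs => by
      have := hstep _ _ (Nat.le_add_right p m) (h.row hs)
      dsimp only; linarith
  have hy : StrictMono fun s => ((p + m) * (ofLex (g s)).1 + (ofLex (g s)).2 : ℤ) :=
    fun s s' hs => hstep _ _ (Nat.le_add_left m p) (h.col hs)
  refine det_monomials_ne_zero (fun s s' => (ofLex (g s')).1 ≤ (ofLex (f s)).1)
    (fun s s' => ((p + m) * ((ofLex (f s)).1 - (ofLex (g s')).1 : ℕ) + (ofLex (f s)).2 +
      (m - (ofLex (g s')).2)) ^ 2) h.le ?_
  intro σ hσ hz
  have hcast : ∀ s s', (ofLex (g s')).1 ≤ (ofLex (f s)).1 →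
      ((((p + m) * ((ofLex (f s)).1 - (ofLex (g s')).1 : ℕ) + (ofLex (f s)).2 +
      (m - (ofLex (g s')).2)) ^ 2 : ℕ) : ℤ) =
      (((p + m) * (ofLex (f s)).1 + (ofLex (f s)).2 + m : ℤ) -
        ((p + m) * (ofLex (g s')).1 + (ofLex (g s')).2 : ℤ)) ^ 2 := by
    intro s s' hs
    have := (ofLex (g s')).2.2.le
    push_cast [Nat.cast_sub (Fin.le_def.1 hs), Nat.cast_sub this]
    ring
  zify
  have h1 := sum_sq_sub_lt_of_strictMono hx hy hσ
  have e1 := sum_congr (rfl : (univ : Finset (Fin w)) = univ) fun i _ => hcast i i (h.le i)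
  have e2 := sum_congr (rfl : (univ : Finset (Fin w)) = univ) fun i _ => hcast (σ i) i (hz i)
  push_cast at e1 e2
  rw [e1, e2]
  exact h1

end Monomial

/-! ### Partial realization of Markov parameters -/

section Realization

variable {K : Type*} [Field K] {p m : ℕ}

/-- The rows of the block Hankel matrix built from `F 1, F 2, ...`: the entry of row `i` in the
`j`-th block of columns. -/
def hankelRow (F : ℕ → Matrix (Fin p) (Fin m) K) (hp : 0 < p) (i j : ℕ) (b : Fin m) : K :=
  F (i / p + j + 1) ⟨i % p, Nat.mod_lt i hp⟩ b

/-- The states are the first `δ` Hankel rows. Moving down `p` rows equals moving one block column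
right, so `A` sends row `i` to the coordinates of row `i + p`. `H` supplies such coordinates for
rows beyond `δ`, valid only in the first `δ / m` block columns. -/
theorem exists_partial_realization (F : ℕ → Matrix (Fin p) (Fin m) K) (hp : 0 < p) (δ : ℕ)
    (H : ∀ y : Fin (δ / m) → Fin m → K, ∃ z : Fin δ → K, ∀ (j : Fin (δ / m)) b,
      ∑ i, z i * hankelRow F hp i j b = y j b) :
    ∃ (A : Matrix (Fin δ) (Fin δ) K) (B : Matrix (Fin δ) (Fin m) K)
      (C : Matrix (Fin p) (Fin δ) K), ∀ d < δ / m + δ / p, C * A ^ d * B = F (d + 1) := by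
  classical
  have hφ : ∀ i : ℕ, ∃ φ : Fin δ → K, (∀ h : i < δ, φ = Pi.single ⟨i, h⟩ 1) ∧
      ∀ j b, (i < δ ∨ j < δ / m) → ∑ s, φ s * hankelRow F hp s j b = hankelRow F hp i j b := by
    intro i
    by_cases hi : i < δ
    · refine ⟨Pi.single ⟨i, hi⟩ 1, fun _ => rfl, fun j b _ => ?_⟩
      simp [Pi.single_apply]
    · obtain ⟨z, hz⟩ := H fun j b => hankelRow F hp i j b
      refine ⟨z, fun h => absurd h hi, fun j b h => hz ⟨j, h.resolve_left hi⟩ b⟩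
  choose φ hφ1 hφ2 using hφ
  have hshift : ∀ i j : ℕ, ∀ b, hankelRow F hp (i + p) j b = hankelRow F hp i (j + 1) b := by
    intro i j b
    simp only [hankelRow, Nat.add_mod_right, Nat.add_div_right i hp]
    congr 2
    omega
  set A : Matrix (Fin δ) (Fin δ) K := Matrix.of fun i => φ (i + p)
  set R : ℕ → Matrix (Fin δ) (Fin m) K := fun j => Matrix.of fun i b => hankelRow F hp i j b
  set C : Matrix (Fin p) (Fin δ) K := Matrix.of fun a => φ a
  have hAR : ∀ j < δ / m, A * R j = R (j + 1) := by
    intro j hj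
    ext i b
    simp only [A, R, Matrix.mul_apply, Matrix.of_apply]
    rw [hφ2 _ _ _ (.inr hj), hshift]
  have hAB : ∀ j ≤ δ / m, A ^ j * R 0 = R j := by
    intro j
    induction j with
    | zero => simp
    | succ j ih => intro hj; rw [pow_succ', Matrix.mul_assoc, ih (by omega), hAR j (by omega)]
  have hCA : ∀ e ≤ δ / p, C * A ^ e = Matrix.of fun a : Fin p => φ (a + e * p) := by
    intro e
    induction e with
    | zero => intro _; ext; simp [C]
    | succ e ih =>
      intro he
      rw [pow_succ, ← Matrix.mul_assoc, ih (by omega)]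
      ext a s
      have hlt : (a : ℕ) + e * p < δ := by
        have := (Nat.le_div_iff_mul_le hp).1 he
        have := a.2
        rw [Nat.succ_mul] at *; omega
      simp only [Matrix.mul_apply, Matrix.of_apply, A]
      rw [hφ1 _ hlt]
      simp [Pi.single_apply, Nat.succ_mul, add_assoc]
  -- `e` shifts are made on the row side and `j` on the column side. The reached row `a + e * p`
  -- must be one of the first `δ`, or the column must lie in the controlled range.
  have hCAR : ∀ e j : ℕ, e ≤ δ / p → j ≤ δ / m → (j < δ / m ∨ e < δ / p) →
      C * A ^ (e + j) * R 0 = F (e + j + 1) := by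
    intro e j he hj h
    rw [pow_add, ← Matrix.mul_assoc, Matrix.mul_assoc, hAB j hj, hCA e he]
    ext a b
    simp only [Matrix.mul_apply, Matrix.of_apply, R]
    rw [hφ2]
    · simp only [hankelRow, Nat.add_mul_mod_self_right, Nat.mod_eq_of_lt a.2,
        Nat.add_mul_div_right _ _ hp, Nat.div_eq_of_lt a.2, zero_add]
    · refine h.symm.imp_left fun h => ?_
      have := (Nat.le_div_iff_mul_le hp).1 (Nat.succ_le_of_lt h)
      have := a.2
      rw [Nat.succ_mul] at *; omega
  refine ⟨A, R 0, C, fun d hd => ?_⟩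
  rcases lt_or_ge d (δ / p) with h | h
  · exact hCAR d 0 h.le (Nat.zero_le _) (.inr h)
  · have := hCAR (δ / p) (d - δ / p) le_rfl (by omega) (.inl (by omega))
    rwa [Nat.add_sub_cancel' h] at this

/-- The rows of the block Toeplitz matrix that meet the Hankel matrix of a system of order `δ`. -/
def hankelRowIndex (p m δ j : ℕ) (hp : 0 < p) (s : Fin (δ / m * m)) : Fin (j + 1) ×ₗ Fin p :=
  toLex (Fin.ofNat (j + 1) (δ / m + s / p), ⟨s % p, Nat.mod_lt _ hp⟩)

/-- The columns of the block Toeplitz matrix that meet the Hankel matrix of a system of order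
`δ`. -/
def hankelColIndex (m δ j : ℕ) (hm : 0 < m) (s : Fin (δ / m * m)) : Fin (j + 1) ×ₗ Fin m :=
  toLex (Fin.ofNat (j + 1) (s / m), ⟨s % m, Nat.mod_lt _ hm⟩)

/-- `Fin.ofNat` reduces modulo `j + 1`; the bound on `j` prevents wrap-around. -/
theorem hankelRowIndex_fst {δ j : ℕ} (hp : 0 < p) (hj : δ / m + δ / p ≤ j)
    (s : Fin (δ / m * m)) :
    ((ofLex (hankelRowIndex p m δ j hp s)).1 : ℕ) = δ / m + s / p := by
  have h1 : (s : ℕ) / p ≤ δ / p :=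
    Nat.div_le_div_right (s.2.le.trans (Nat.div_mul_le_self δ m))
  simp only [hankelRowIndex, ofLex_toLex, Fin.val_ofNat]
  exact Nat.mod_eq_of_lt (by omega)

theorem hankelColIndex_fst {δ j : ℕ} (hm : 0 < m) (hj : δ / m ≤ j) (s : Fin (δ / m * m)) :
    ((ofLex (hankelColIndex m δ j hm s)).1 : ℕ) = s / m ∧ (s : ℕ) / m < δ / m := by
  have h1 : (s : ℕ) / m < δ / m := (Nat.div_lt_iff_lt_mul hm).2 s.2
  refine ⟨?_, h1⟩
  simp only [hankelColIndex, ofLex_toLex, Fin.val_ofNat]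
  exact Nat.mod_eq_of_lt (by omega)

theorem lex_div_mod_lt {q s s' : ℕ} (h : s < s') :
    s / q < s' / q ∨ s / q = s' / q ∧ s % q < s' % q := by
  rcases (Nat.div_le_div_right (c := q) h.le).lt_or_eq with h1 | h1
  · exact .inl h1
  · refine .inr ⟨h1, ?_⟩
    have h2 := Nat.div_add_mod s q
    have h3 := Nat.div_add_mod s' q
    rw [h1] at h2
    omega

theorem isAdmissible_hankelIndex {δ j : ℕ} (hp : 0 < p) (hm : 0 < m) (hj : δ / m + δ / p ≤ j) :
    IsAdmissible (hankelRowIndex p m δ j hp) (hankelColIndex m δ j hm) where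
  row s s' h := by
    rw [Prod.Lex.lt_iff, Fin.lt_def, Fin.ext_iff, hankelRowIndex_fst hp hj,
      hankelRowIndex_fst hp hj]
    rcases lex_div_mod_lt (q := p) (Fin.lt_def.1 h) with h1 | ⟨h1, h2⟩
    · exact .inl (by omega)
    · exact .inr ⟨by omega, h2⟩
  col s s' h := by
    rw [Prod.Lex.lt_iff, Fin.lt_def, Fin.ext_iff, (hankelColIndex_fst hm (le_trans (Nat.le_add_right _ _) hj) s).1,
      (hankelColIndex_fst hm (le_trans (Nat.le_add_right _ _) hj) s').1]
    exact lex_div_mod_lt (q := m) (Fin.lt_def.1 h)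
  le s := by
    rw [Fin.le_def, hankelRowIndex_fst hp hj, (hankelColIndex_fst hm (le_trans (Nat.le_add_right _ _) hj) s).1]
    have := (hankelColIndex_fst hm (le_trans (Nat.le_add_right _ _) hj) s).2
    exact this.le.trans (Nat.le_add_right _ _)

/-- The Toeplitz minor is a Hankel minor with its block columns in reverse order. Its invertibility
solves the system on the first `δ / m * m` rows; the remaining coefficients are set to zero. -/
theorem hankel_surjective {F : ℕ → Matrix (Fin p) (Fin m) K} {δ j : ℕ} (hp : 0 < p) (hm : 0 < m)
    (hj : δ / m + δ / p ≤ j)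
    (hdet : ((blockToeplitz F j).submatrix (hankelRowIndex p m δ j hp)
      (hankelColIndex m δ j hm)).det ≠ 0) (y : Fin (δ / m) → Fin m → K) :
    ∃ z : Fin δ → K, ∀ (j : Fin (δ / m)) b, ∑ i, z i * hankelRow F hp i j b = y j b := by
  set M := (blockToeplitz F j).submatrix (hankelRowIndex p m δ j hp) (hankelColIndex m δ j hm)
    with hM
  have hle : δ / m * m ≤ δ := Nat.div_mul_le_self δ m
  have hent : ∀ s t : Fin (δ / m * m), M s t =
      hankelRow F hp s (δ / m - 1 - t / m) ⟨t % m, Nat.mod_lt _ hm⟩ := by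
    intro s t
    have h1 := hankelRowIndex_fst hp hj s
    obtain ⟨h2, h3⟩ := hankelColIndex_fst hm (le_trans (Nat.le_add_right _ _) hj) t
    simp only [hM, Matrix.submatrix_apply, blockToeplitz, Matrix.of_apply, Fin.le_def]
    have h5 := Nat.zero_le (s / p : ℕ)
    have h6 := Nat.zero_le (t / m : ℕ)
    rw [if_pos (by omega), h1, h2, hankelRow]
    have h4 : δ / m + s / p - t / m = (s : ℕ) / p + (δ / m - 1 - t / m) + 1 := by omega
    rw [h4]
    rfl
  set Y : Fin (δ / m * m) → K := fun t =>
    y ⟨δ / m - 1 - t / m, by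
      have := (Nat.div_lt_iff_lt_mul hm).2 t.2
      have := Nat.zero_le (t / m : ℕ)
      omega⟩ ⟨t % m, Nat.mod_lt _ hm⟩ with hY
  obtain ⟨z, hz⟩ : ∃ z, z ᵥ* M = Y :=
    ⟨Y ᵥ* M⁻¹, by rw [Matrix.vecMul_vecMul, Matrix.nonsing_inv_mul _ (isUnit_iff_ne_zero.2 hdet),
      Matrix.vecMul_one]⟩
  refine ⟨fun i => if h : (i : ℕ) < δ / m * m then z ⟨i, h⟩ else 0, fun i b => ?_⟩
  have hb := b.2
  have hi := i.2
  have hidx : (δ / m - 1 - i) * m + b < δ / m * m := by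
    calc (δ / m - 1 - i) * m + b < (δ / m - 1 - i + 1) * m := by rw [add_mul]; omega
      _ ≤ δ / m * m := Nat.mul_le_mul_right _ (by omega)
  set t : Fin (δ / m * m) := ⟨(δ / m - 1 - i) * m + b, hidx⟩
  have ht1 : (t : ℕ) / m = δ / m - 1 - i := by
    simp only [t]
    rw [mul_comm, Nat.mul_add_div hm, Nat.div_eq_of_lt hb, add_zero]
  have ht2 : (t : ℕ) % m = b := by
    simp only [t]
    rw [Nat.mul_add_mod_self_right, Nat.mod_eq_of_lt hb]
  have ht3 : δ / m - 1 - (t : ℕ) / m = i := by omega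
  have := congrFun hz t
  simp only [Matrix.vecMul, dotProduct, hent, hY, ht3, ht2, Fin.eta] at this
  rw [← this]
  symm
  refine Fintype.sum_of_injective (Fin.castLE hle) (Fin.castLE_injective hle) _ _ ?_ ?_
  · intro s hs
    have : ¬ (s : ℕ) < δ / m * m := fun h => hs ⟨⟨s, h⟩, rfl⟩
    simp [this]
  · intro s
    simp

end Realization

/-! ### Markov parameters and the column distances of a system -/

namespace LinSys

variable {K R R' : Type*} {n k δ : ℕ}

/-- The Markov parameters `D, C B, C A B, C A² B, ...` of a system. -/
def markov [CommRing R] (S : LinSys R n k δ) : ℕ → Matrix (Fin (n - k)) (Fin k) R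
  | 0 => S.D
  | d + 1 => S.C * S.A ^ d * S.B

/-- Base change of a system along a ring homomorphism. -/
def map [CommRing R] [CommRing R'] (φ : R →+* R') (S : LinSys R n k δ) : LinSys R' n k δ where
  A := S.A.map φ
  B := S.B.map φ
  C := S.C.map φ
  D := S.D.map φ

/-- The system with a given vector of coordinates, inverse to `LinSys.toAffine`. -/
def ofAffine (x : (Fin δ ⊕ Fin (n - k)) × (Fin δ ⊕ Fin k) → R) : LinSys R n k δ where
  A := Matrix.of fun i j => x (.inl i, .inl j)
  B := Matrix.of fun i j => x (.inl i, .inr j)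
  C := Matrix.of fun i j => x (.inr i, .inl j)
  D := Matrix.of fun i j => x (.inr i, .inr j)

theorem toAffine_ofAffine (x : (Fin δ ⊕ Fin (n - k)) × (Fin δ ⊕ Fin k) → R) :
    (ofAffine x : LinSys R n k δ).toAffine = x := by
  ext ⟨i, j⟩
  rcases i with i | i <;> rcases j with j | j <;> rfl

theorem ofAffine_toAffine (S : LinSys R n k δ) : ofAffine S.toAffine = S := rfl

theorem map_ofAffine [CommRing R] [CommRing R'] (φ : R →+* R')
    (x : (Fin δ ⊕ Fin (n - k)) × (Fin δ ⊕ Fin k) → R) :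
    (ofAffine x : LinSys R n k δ).map φ = ofAffine (φ ∘ x) := rfl

theorem markov_map [CommRing R] [CommRing R'] (φ : R →+* R') (S : LinSys R n k δ) (d : ℕ) :
    (S.map φ).markov d = (S.markov d).map φ := by
  cases d with
  | zero => rfl
  | succ d => simp [markov, map, Matrix.map_mul, Matrix.map_pow]

theorem mem_code_iff [Field K] (S : LinSys K n k δ) (v : CodeSeq K n k) :
    v ∈ S.code ↔ ∀ t, v.parity t = blockConv S.markov v.info t := by
  have hx : ∀ x : ℕ → Fin δ → K, x 0 = 0 → (∀ t, x (t + 1) = S.A *ᵥ x t + S.B *ᵥ v.info t) →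
      ∀ t, S.C *ᵥ x t + S.D *ᵥ v.info t = blockConv S.markov v.info t := by
    intro x h0 h1 t
    have h2 : ∀ t, x t = ∑ s ∈ Finset.range t, (S.A ^ (t - 1 - s) * S.B) *ᵥ v.info s := by
      intro t
      induction t with
      | zero => simpa using h0
      | succ t ih =>
        rw [h1, ih, Finset.sum_range_succ, Matrix.mulVec_sum]
        congr 1
        · refine Finset.sum_congr rfl fun s hs => ?_
          have hs := Finset.mem_range.1 hs
          rw [Matrix.mulVec_mulVec, ← Matrix.mul_assoc, ← pow_succ']
          congr 3
          omega
        · simp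
    rw [blockConv, Finset.sum_range_succ, h2, Matrix.mulVec_sum]
    congr 1
    · refine Finset.sum_congr rfl fun s hs => ?_
      have hs := Finset.mem_range.1 hs
      rw [Matrix.mulVec_mulVec, ← Matrix.mul_assoc]
      obtain ⟨d, rfl⟩ : ∃ d, t = s + d + 1 := ⟨t - s - 1, by omega⟩
      rw [show s + d + 1 - 1 - s = d by omega, show s + d + 1 - s = d + 1 by omega]
      rfl
    · rw [Nat.sub_self]; rfl
  constructor
  · rintro ⟨x, h0, h1, h2⟩ t
    rw [h2, hx x h0 h1]
  · intro h
    let x : ℕ → Fin δ → K := fun t => Nat.rec 0 (fun t y => S.A *ᵥ y + S.B *ᵥ v.info t) t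
    exact ⟨x, rfl, fun _ => rfl, fun t => by rw [h, hx x rfl (fun _ => rfl)]⟩

theorem hammingNorm_codeSeq [Field K] [DecidableEq K] (v : CodeSeq K n k) (t : ℕ) :
    hammingNorm (v t) = hammingNorm (v.parity t) + hammingNorm (v.info t) := by
  simp only [hammingNorm, Finset.card_filter, Fintype.sum_sum_type]
  rfl

open Classical in
theorem hasMaximumDistanceProfile_iff [Field K] (hk : 0 < k) (S : LinSys K n k δ) :
    HasMaximumDistanceProfile S.code δ ↔
      ∀ j ≤ δ / k + δ / (n - k), ∀ u : ℕ → Fin k → K, u 0 ≠ 0 →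
        (n - k) * (j + 1) + 1 ≤ ∑ t ∈ Finset.range (j + 1),
          (hammingNorm (blockConv S.markov u t) + hammingNorm (u t)) := by
  have hcode : ∀ u : ℕ → Fin k → K, ∃ v ∈ S.code, v.info = u ∧
      ∀ t, hammingNorm (v t) = hammingNorm (blockConv S.markov u t) + hammingNorm (u t) := by
    intro u
    let v : CodeSeq K n k := fun t => Sum.elim (blockConv S.markov u t) (u t)
    exact ⟨v, (S.mem_code_iff v).2 fun t => rfl, rfl, fun t => hammingNorm_codeSeq v t⟩
  refine forall₂_congr fun j _ => ⟨fun h u hu => ?_, fun h => ?_⟩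
  · obtain ⟨v, hv, hvu, hw⟩ := hcode u
    rw [← h]
    refine Nat.sInf_le ⟨v, hv, by rwa [hvu], Finset.sum_congr rfl fun t _ => ?_⟩
    rw [← hw]
  -- A unit impulse has input weight 1 and output weight at most `(n - k) * (j + 1)`, so the upper
  -- bound always holds and only the lower bound is a condition.
  · set u : ℕ → Fin k → K := fun t => if t = 0 then Pi.single ⟨0, hk⟩ 1 else 0 with hu
    obtain ⟨v, hv, hvu, hw⟩ := hcode u
    have hu0 : u 0 ≠ 0 := by simp [hu]
    have hmem : (∑ t ∈ Finset.range (j + 1), hammingNorm (v t)) ∈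
        {d : ℕ | ∃ v ∈ S.code, v.info 0 ≠ 0 ∧
          d = ∑ t ∈ Finset.range (j + 1), hammingNorm (v t)} :=
      ⟨v, hv, by rwa [hvu], rfl⟩
    refine le_antisymm ((Nat.sInf_le hmem).trans ?_) (le_csInf ⟨_, hmem⟩ ?_)
    · rw [Finset.sum_congr rfl fun t _ => hw t, Finset.sum_add_distrib]
      refine add_le_add ?_ ?_
      · calc ∑ t ∈ Finset.range (j + 1), hammingNorm (blockConv S.markov u t)
            ≤ ∑ _t ∈ Finset.range (j + 1), (n - k) := Finset.sum_le_sum fun t _ => by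
              simpa using hammingNorm_le_card_fintype (x := blockConv S.markov u t)
          _ = (n - k) * (j + 1) := by simp [mul_comm]
      · rw [Finset.sum_eq_single 0]
        · simp only [hu, if_true, hammingNorm]
          refine Finset.card_le_one.2 fun a ha b hb => ?_
          simp only [Finset.mem_filter, Finset.mem_univ, true_and, Pi.single_apply, ne_eq,
            ite_eq_right_iff, one_ne_zero, imp_false, not_not] at ha hb
          rw [ha, hb]
        · intro t _ ht
          simp [hu, ht]
        · simp
    · rintro _ ⟨v', hv', hv0, rfl⟩
      refine (h v'.info hv0).trans (Finset.sum_le_sum fun t _ => ?_)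
      rw [hammingNorm_codeSeq, (S.mem_code_iff v').1 hv']

theorem hasMaximumDistanceProfile_iff_isSuperregular [Field K] (hk : 0 < k)
    (S : LinSys K n k δ) :
    HasMaximumDistanceProfile S.code δ ↔ IsSuperregular S.markov (δ / k + δ / (n - k)) := by
  classical
  rw [hasMaximumDistanceProfile_iff hk]
  constructor
  · intro h
    refine isSuperregular_of_le_weight fun j hj u hu => ?_
    convert h j hj u hu
  · intro h j hj u hu
    convert h.le_weight hj u hu

end LinSys

/-! ### Full rank and maximal minors -/

theorem Matrix.rank_eq_iff_exists_det_ne_zero {K ι : Type*} [Field K] [Fintype ι] {δ : ℕ}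
    (M : Matrix (Fin δ) ι K) : M.rank = δ ↔ ∃ g : Fin δ → ι, (M.submatrix id g).det ≠ 0 := by
  constructor
  · intro h
    obtain ⟨κ, a, ha, hspan, hli⟩ := exists_linearIndependent' K M.col
    have : Finite κ := Finite.of_injective a ha
    have := Fintype.ofFinite κ
    have hcard : Fintype.card κ = δ := by
      rw [← finrank_span_eq_card hli, hspan, ← Matrix.rank_eq_finrank_span_cols, h]
    let e : Fin δ ≃ κ := (Fintype.equivFinOfCardEq hcard).symm
    refine ⟨a ∘ e, ?_⟩
    have h1 : (M.submatrix id (a ∘ e)).col = (M.col ∘ a) ∘ e := rfl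
    have h2 : LinearIndependent K (M.submatrix id (a ∘ e)).col := by
      rw [h1]; exact hli.comp e e.injective
    have h3 := (Matrix.isUnit_iff_isUnit_det _).1 (Matrix.linearIndependent_cols_iff_isUnit.1 h2)
    exact h3.ne_zero
  · rintro ⟨g, hg⟩
    refine le_antisymm (M.rank_le_card_height.trans_eq (Fintype.card_fin δ)) ?_
    calc δ = (M.submatrix id g).rank := by rw [Matrix.rank_of_det_ne_zero hg, Fintype.card_fin]
      _ ≤ M.rank := Matrix.rank_submatrix_le M id g

/-- The matrix with block columns `B, A B, ..., A ^ (δ - 1) B`. -/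
def controllabilityMatrix {R : Type*} [CommRing R] {δ m : ℕ} (A : Matrix (Fin δ) (Fin δ) R)
    (B : Matrix (Fin δ) (Fin m) R) : Matrix (Fin δ) (Fin δ × Fin m) R :=
  Matrix.of fun i c => (A ^ (c.1 : ℕ) * B) i c.2

theorem controllabilityMatrix_map {R R' : Type*} [CommRing R] [CommRing R'] (φ : R →+* R')
    {δ m : ℕ} (A : Matrix (Fin δ) (Fin δ) R) (B : Matrix (Fin δ) (Fin m) R) :
    controllabilityMatrix (A.map φ) (B.map φ) = (controllabilityMatrix A B).map φ := by
  ext i c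
  simp [controllabilityMatrix, ← Matrix.map_pow, ← Matrix.map_mul]

theorem exists_det_controllabilityMatrix_ne_zero (K : Type*) [Field K] (δ : ℕ) {m : ℕ}
    (hm : 0 < m) : ∃ (A : Matrix (Fin δ) (Fin δ) K) (B : Matrix (Fin δ) (Fin m) K)
      (g : Fin δ → Fin δ × Fin m), ((controllabilityMatrix A B).submatrix id g).det ≠ 0 := by
  -- Nilpotent shift: every column of `A ^ c * B` is the unit vector `e_c`.
  set A : Matrix (Fin δ) (Fin δ) K := Matrix.of fun i j => if (i : ℕ) = j + 1 then 1 else 0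
  set B : Matrix (Fin δ) (Fin m) K := Matrix.of fun i _ => if (i : ℕ) = 0 then 1 else 0
  have hAB : ∀ c, A ^ c * B = Matrix.of fun (i : Fin δ) (_ : Fin m) => if (i : ℕ) = c then (1 : K) else 0 := by
    intro c
    induction c with
    | zero => simp [B]
    | succ c ih =>
      rw [pow_succ', Matrix.mul_assoc, ih]
      ext i b
      simp only [A, Matrix.mul_apply, Matrix.of_apply, mul_ite, mul_one, mul_zero]
      by_cases hi : (i : ℕ) = c + 1
      · rw [if_pos hi, Finset.sum_eq_single ⟨c, by omega⟩]
        · simp [hi]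
        · intro s _ hs
          rw [if_neg fun h => hs (Fin.ext h)]
        · simp
      · rw [if_neg hi]
        refine Finset.sum_eq_zero fun s _ => ?_
        split_ifs with h1 h2
        · omega
        · rfl
        · rfl
  refine ⟨A, B, fun i => (i, ⟨0, hm⟩), ?_⟩
  have : (controllabilityMatrix A B).submatrix id (fun i => (i, ⟨0, hm⟩)) = 1 := by
    ext i j
    simp [controllabilityMatrix, hAB, Matrix.one_apply, Fin.ext_iff]
  rw [this, Matrix.det_one]
  exact one_ne_zero

namespace LinSys

variable {K : Type*} [Field K] {n k δ : ℕ}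

theorem isControllable_iff (S : LinSys K n k δ) : S.IsControllable ↔
    ∃ g : Fin δ → Fin δ × Fin k, ((controllabilityMatrix S.A S.B).submatrix id g).det ≠ 0 :=
  Matrix.rank_eq_iff_exists_det_ne_zero _

theorem isObservable_iff (S : LinSys K n k δ) : S.IsObservable ↔
    ∃ g : Fin δ → Fin δ × Fin (n - k),
      ((controllabilityMatrix S.Aᵀ S.Cᵀ).submatrix id g).det ≠ 0 := by
  rw [← Matrix.rank_eq_iff_exists_det_ne_zero, ← Matrix.rank_transpose, IsObservable]
  have : (controllabilityMatrix S.Aᵀ S.Cᵀ)ᵀ =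
      Matrix.of fun (r : Fin δ × Fin (n - k)) (i : Fin δ) => (S.C * S.A ^ (r.1 : ℕ)) r.2 i := by
    ext r i
    simp only [controllabilityMatrix, Matrix.transpose_apply, Matrix.of_apply,
      ← Matrix.transpose_pow, ← Matrix.transpose_mul]
  rw [this]

theorem isMDP_iff (hk : 0 < k) (S : LinSys K n k δ) : S.IsMDP ↔
    (∃ g : Fin δ → Fin δ × Fin k, ((controllabilityMatrix S.A S.B).submatrix id g).det ≠ 0) ∧
    (∃ g : Fin δ → Fin δ × Fin (n - k),
      ((controllabilityMatrix S.Aᵀ S.Cᵀ).submatrix id g).det ≠ 0) ∧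
    IsSuperregular S.markov (δ / k + δ / (n - k)) := by
  rw [IsMDP, isControllable_iff, isObservable_iff,
    hasMaximumDistanceProfile_iff_isSuperregular hk]

end LinSys

/-! ### Generic sets given by finitely many polynomials -/

/-- For density: if `q` vanishes on `U`, then `q * P i` vanishes everywhere, so it is zero over an
infinite field, forcing `q = 0`. -/
theorem isGeneric_of_eval_ne_zero {σ K ι : Type*} [Field K] [Infinite K]
    {U : Set (σ → K)} (P : ι → MvPolynomial σ K)
    (hU : ∀ x, x ∈ U ↔ ∃ i, MvPolynomial.eval x (P i) ≠ 0) (hP : ∃ i, P i ≠ 0) :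
    IsGeneric U := by
  obtain ⟨i, hi⟩ := hP
  refine ⟨?_, ⟨Ideal.span (Set.range P), ?_⟩, ?_⟩
  · by_contra hne
    refine hi (MvPolynomial.funext fun x => ?_)
    by_contra hx
    exact hne ⟨x, (hU x).2 ⟨i, by simpa using hx⟩⟩
  · ext x
    rw [MvPolynomial.zeroLocus_span, Set.mem_compl_iff, hU]
    simp [MvPolynomial.aeval_eq_eval]
  · rintro Z ⟨I, rfl⟩ hUI
    refine Set.eq_univ_of_forall fun x => MvPolynomial.mem_zeroLocus_iff.2 fun q hq => ?_
    have hqP : q * P i = 0 := by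
      refine MvPolynomial.funext fun y => ?_
      rw [map_mul, map_zero, mul_eq_zero]
      by_cases hy : MvPolynomial.eval y (P i) = 0
      · exact .inr hy
      · have := MvPolynomial.mem_zeroLocus_iff.1 (hUI ((hU y).2 ⟨i, hy⟩)) q hq
        rw [MvPolynomial.aeval_eq_eval] at this
        exact .inl this
    rw [(mul_eq_zero.1 hqP).resolve_right hi, map_zero]

/-! ### Minors under base change -/

theorem blockToeplitz_map {R R' : Type*} [CommRing R] [CommRing R'] (φ : R →+* R') {p m : ℕ}
    (F : ℕ → Matrix (Fin p) (Fin m) R) (j : ℕ) :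
    blockToeplitz (fun d => (F d).map φ) j = (blockToeplitz F j).map φ := by
  ext r c
  simp [blockToeplitz, apply_ite φ]

theorem map_det_submatrix {R R' ι κ : Type*} [CommRing R] [CommRing R'] (φ : R →+* R') {w : ℕ}
    (M : Matrix ι κ R) (f : Fin w → ι) (g : Fin w → κ) :
    φ (M.submatrix f g).det = ((M.map φ).submatrix f g).det := by
  rw [RingHom.map_det]
  rfl

/-- Bounding the size leaves finitely many admissible minors, so their product is a polynomial. -/
theorem IsAdmissible.le_card {p m j w : ℕ} {f : Fin w → Fin (j + 1) ×ₗ Fin p}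
    {g : Fin w → Fin (j + 1) ×ₗ Fin m} (h : IsAdmissible f g) : w ≤ (j + 1) * p := by
  simpa using Fintype.card_le_of_injective f h.row.injective

/-- The admissible minors of the block Toeplitz matrices up to order `L`. -/
structure AdmissibleMinor (p m L : ℕ) where
  ord : Fin (L + 1)
  size : Fin ((L + 1) * p + 1)
  row : Fin size → Fin (ord + 1) ×ₗ Fin p
  col : Fin size → Fin (ord + 1) ×ₗ Fin m
  isAdmissible : IsAdmissible row col

instance (p m L : ℕ) : Finite (AdmissibleMinor p m L) := by
  refine Finite.of_injective (β := Σ (j : Fin (L + 1)) (w : Fin ((L + 1) * p + 1)),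
    (Fin w → Fin (j + 1) ×ₗ Fin p) × (Fin w → Fin (j + 1) ×ₗ Fin m))
    (fun x => ⟨x.ord, x.size, x.row, x.col⟩) ?_
  rintro ⟨j, w, f, g, h⟩ ⟨j', w', f', g', h'⟩ he
  simp only [Sigma.mk.injEq] at he
  obtain ⟨rfl, he⟩ := he
  simp only [heq_eq_eq, Sigma.mk.injEq] at he
  obtain ⟨rfl, he⟩ := he
  simp only [heq_eq_eq, Prod.mk.injEq] at he
  obtain ⟨rfl, rfl⟩ := he
  rfl

/-- The value of an admissible minor. -/
def AdmissibleMinor.det {R : Type*} [CommRing R] {p m L : ℕ} (x : AdmissibleMinor p m L)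
    (F : ℕ → Matrix (Fin p) (Fin m) R) : R :=
  ((blockToeplitz F x.ord).submatrix x.row x.col).det

theorem isSuperregular_iff {R : Type*} [CommRing R] {p m : ℕ}
    (F : ℕ → Matrix (Fin p) (Fin m) R) (L : ℕ) :
    IsSuperregular F L ↔ ∀ x : AdmissibleMinor p m L, x.det F ≠ 0 := by
  refine ⟨fun h x => h x.ord (Nat.le_of_lt_succ x.ord.2) _ _ _ x.isAdmissible,
    fun h j hj w f g hfg => ?_⟩
  exact h ⟨⟨j, Nat.lt_succ_of_le hj⟩, ⟨w, Nat.lt_succ_of_le (hfg.le_card.trans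
    (Nat.mul_le_mul_right p (Nat.succ_le_succ hj)))⟩, f, g, hfg⟩

theorem AdmissibleMinor.map_det {R R' : Type*} [CommRing R] [CommRing R'] (φ : R →+* R')
    {p m L : ℕ} (x : AdmissibleMinor p m L) (F : ℕ → Matrix (Fin p) (Fin m) R) :
    φ (x.det F) = x.det fun d => (F d).map φ := by
  rw [AdmissibleMinor.det, map_det_submatrix, ← blockToeplitz_map]
  rfl

theorem blockToeplitz_congr {R : Type*} [CommRing R] {p m j : ℕ}
    {F G : ℕ → Matrix (Fin p) (Fin m) R} (h : ∀ d ≤ j, F d = G d) :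
    blockToeplitz F j = blockToeplitz G j := by
  ext r c
  have := (ofLex r).1.2
  simp only [blockToeplitz, Matrix.of_apply]
  rw [h _ (by omega)]

/-! ### Genericity of MDP systems and descent to subfields -/

namespace LinSys

theorem exists_det_ne_zero {K : Type*} [Field K] [Infinite K] {n k δ : ℕ} (hk : 0 < k)
    (hkn : k < n) (x : AdmissibleMinor (n - k) k (δ / k + δ / (n - k))) :
    ∃ S : LinSys K n k δ, x.det S.markov ≠ 0 := by
  have hp : 0 < n - k := Nat.sub_pos_of_lt hkn
  have hH := isAdmissible_hankelIndex (δ := δ) hp hk le_rfl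
  have h1 := det_blockToeplitz_monomialBlocks_ne_zero (K := K) x.isAdmissible
  have h2 := det_blockToeplitz_monomialBlocks_ne_zero (K := K) hH
  -- One specialization keeps both the given minor and the Hankel minor needed for realization
  -- nonzero.
  obtain ⟨t, ht⟩ := not_forall.1 (mt (Polynomial.funext (q := 0)) (mul_ne_zero h1 h2))
  rw [Polynomial.eval_mul, Polynomial.eval_zero] at ht
  have ht1 := left_ne_zero_of_mul ht
  have ht2 := right_ne_zero_of_mul ht
  rw [← Polynomial.coe_evalRingHom, map_det_submatrix, ← blockToeplitz_map] at ht1 ht2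
  set F : ℕ → Matrix (Fin (n - k)) (Fin k) K := fun d =>
    (monomialBlocks K (n - k) k d).map (Polynomial.evalRingHom t)
  obtain ⟨A, B, C, hABC⟩ := exists_partial_realization F hp δ
    (hankel_surjective hp hk le_rfl ht2)
  refine ⟨⟨A, B, C, F 0⟩, ?_⟩
  rw [AdmissibleMinor.det, blockToeplitz_congr (G := F)]
  · exact ht1
  · rintro (_ | d) hd
    · rfl
    · have := x.ord.2
      exact hABC d (by omega)

/-- The system whose matrix entries are indeterminates. -/
noncomputable def universal (K : Type*) [Field K] (n k δ : ℕ) :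
    LinSys (MvPolynomial ((Fin δ ⊕ Fin (n - k)) × (Fin δ ⊕ Fin k)) K) n k δ :=
  ofAffine MvPolynomial.X

theorem universal_map {K : Type*} [Field K] {n k δ : ℕ}
    (x : (Fin δ ⊕ Fin (n - k)) × (Fin δ ⊕ Fin k) → K) :
    (universal K n k δ).map (MvPolynomial.eval x) = ofAffine x := by
  rw [universal, map_ofAffine]
  congr 1
  ext i
  simp

variable {K : Type*} [Field K] {n k δ : ℕ}

/-- A minor of the controllability matrix as a polynomial in the entries of the system. -/
noncomputable def controllabilityPoly (K : Type*) [Field K] (n k δ : ℕ)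
    (g : Fin δ → Fin δ × Fin k) :
    MvPolynomial ((Fin δ ⊕ Fin (n - k)) × (Fin δ ⊕ Fin k)) K :=
  ((controllabilityMatrix (universal K n k δ).A (universal K n k δ).B).submatrix id g).det

/-- A minor of the observability matrix as a polynomial in the entries of the system. -/
noncomputable def observabilityPoly (K : Type*) [Field K] (n k δ : ℕ)
    (g : Fin δ → Fin δ × Fin (n - k)) :
    MvPolynomial ((Fin δ ⊕ Fin (n - k)) × (Fin δ ⊕ Fin k)) K :=
  ((controllabilityMatrix (universal K n k δ).Aᵀ (universal K n k δ).Cᵀ).submatrix id g).det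

theorem eval_controllabilityPoly (S : LinSys K n k δ) (g : Fin δ → Fin δ × Fin k) :
    MvPolynomial.eval S.toAffine (controllabilityPoly K n k δ g) =
      ((controllabilityMatrix S.A S.B).submatrix id g).det := by
  rw [controllabilityPoly, map_det_submatrix, ← controllabilityMatrix_map]
  change ((controllabilityMatrix ((universal K n k δ).map (MvPolynomial.eval S.toAffine)).A
    ((universal K n k δ).map (MvPolynomial.eval S.toAffine)).B).submatrix id g).det = _
  rw [universal_map, ofAffine_toAffine]

theorem eval_observabilityPoly (S : LinSys K n k δ) (g : Fin δ → Fin δ × Fin (n - k)) :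
    MvPolynomial.eval S.toAffine (observabilityPoly K n k δ g) =
      ((controllabilityMatrix S.Aᵀ S.Cᵀ).submatrix id g).det := by
  rw [observabilityPoly, map_det_submatrix, ← controllabilityMatrix_map]
  change ((controllabilityMatrix ((universal K n k δ).map (MvPolynomial.eval S.toAffine)).Aᵀ
    ((universal K n k δ).map (MvPolynomial.eval S.toAffine)).Cᵀ).submatrix id g).det = _
  rw [universal_map, ofAffine_toAffine]

theorem eval_minorPoly (S : LinSys K n k δ) {L : ℕ} (x : AdmissibleMinor (n - k) k L) :
    MvPolynomial.eval S.toAffine (x.det (universal K n k δ).markov) = x.det S.markov := by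
  rw [AdmissibleMinor.map_det]
  congr 1
  ext1 d
  rw [← markov_map, universal_map, ofAffine_toAffine]

theorem isGeneric_isMDP [Infinite K] (hk : 0 < k) (hkn : k < n) :
    IsGeneric (LinSys.toAffine '' {S : LinSys K n k δ | S.IsMDP}) := by
  have hp : 0 < n - k := Nat.sub_pos_of_lt hkn
  have := Fintype.ofFinite (AdmissibleMinor (n - k) k (δ / k + δ / (n - k)))
  refine isGeneric_of_eval_ne_zero
    -- Existential choices of rank minors become the index of the family; the conjunction of
    -- conditions becomes a product.
    (fun i : (Fin δ → Fin δ × Fin k) × (Fin δ → Fin δ × Fin (n - k)) =>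
      controllabilityPoly K n k δ i.1 * observabilityPoly K n k δ i.2 *
        ∏ x : AdmissibleMinor (n - k) k (δ / k + δ / (n - k)),
          x.det (universal K n k δ).markov) ?_ ?_
  · intro x
    obtain ⟨S, rfl⟩ : ∃ S : LinSys K n k δ, S.toAffine = x := ⟨_, toAffine_ofAffine x⟩
    have hmem : S.toAffine ∈ LinSys.toAffine '' {S : LinSys K n k δ | S.IsMDP} ↔ S.IsMDP := by
      refine ⟨?_, fun h => ⟨S, h, rfl⟩⟩
      rintro ⟨S', hS', he⟩
      rwa [← ofAffine_toAffine S, ← he, ofAffine_toAffine]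
    rw [hmem, isMDP_iff hk, isSuperregular_iff]
    simp only [map_mul, map_prod, eval_controllabilityPoly, eval_observabilityPoly,
      eval_minorPoly, mul_ne_zero_iff, Finset.prod_ne_zero_iff, Finset.mem_univ, true_imp_iff,
      Prod.exists]
    constructor
    · rintro ⟨⟨g, hg⟩, ⟨g', hg'⟩, h⟩
      exact ⟨g, g', ⟨hg, hg'⟩, h⟩
    · rintro ⟨g, g', ⟨hg, hg'⟩, h⟩
      exact ⟨⟨g, hg⟩, ⟨g', hg'⟩, h⟩
  · obtain ⟨A, B, g, hg⟩ := exists_det_controllabilityMatrix_ne_zero K δ hk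
    obtain ⟨A', C', g', hg'⟩ := exists_det_controllabilityMatrix_ne_zero K δ hp
    refine ⟨(g, g'), mul_ne_zero (mul_ne_zero ?_ ?_) (Finset.prod_ne_zero_iff.2 ?_)⟩
    · intro h
      have := eval_controllabilityPoly (⟨A, B, 0, 0⟩ : LinSys K n k δ) g
      rw [h, map_zero] at this
      exact hg this.symm
    · intro h
      have := eval_observabilityPoly (⟨A'ᵀ, 0, C'ᵀ, 0⟩ : LinSys K n k δ) g'
      rw [h, map_zero, Matrix.transpose_transpose, Matrix.transpose_transpose] at this
      exact hg' this.symm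
    · intro x _ h
      obtain ⟨S, hS⟩ := exists_det_ne_zero (K := K) hk hkn x
      rw [← eval_minorPoly, h, map_zero] at hS
      exact hS rfl

/-- All conditions are nonvanishing of minors, and minors commute with `φ`, so a minor that vanishes
over `K` vanishes over `K'`. -/
theorem IsMDP.of_map {K' : Type*} [Field K'] (hk : 0 < k) (φ : K →+* K') {S : LinSys K n k δ}
    (h : (S.map φ).IsMDP) : S.IsMDP := by
  rw [isMDP_iff hk] at h ⊢
  obtain ⟨⟨g, hg⟩, ⟨g', hg'⟩, h⟩ := h
  refine ⟨⟨g, fun h0 => hg ?_⟩, ⟨g', fun h0 => hg' ?_⟩, ?_⟩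
  · change ((controllabilityMatrix (S.A.map φ) (S.B.map φ)).submatrix id g).det = 0
    rw [controllabilityMatrix_map, ← map_det_submatrix, h0, map_zero]
  · change ((controllabilityMatrix (S.Aᵀ.map φ) (S.Cᵀ.map φ)).submatrix id g').det = 0
    rw [controllabilityMatrix_map, ← map_det_submatrix, h0, map_zero]
  · rw [isSuperregular_iff] at h ⊢
    intro x h0
    apply h x
    rw [funext (markov_map φ S), ← AdmissibleMinor.map_det, h0, map_zero]

end LinSys

theorem mainTheorem1 {F : Type*} [Field F] [Finite F] (n k δ : ℕ)
    (hk : 0 < k) (hkn : k < n) (hδ : 0 < δ) :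
    (∃ E : IntermediateField F (AlgebraicClosure F), FiniteDimensional F E ∧
      ∃ S : LinSys E n k δ, S.IsMDP) ∧
    IsGeneric (LinSys.toAffine '' {S : LinSys (AlgebraicClosure F) n k δ | S.IsMDP}) := by
  have : Infinite (AlgebraicClosure F) := IsAlgClosed.instInfinite
  have hgen := LinSys.isGeneric_isMDP (K := AlgebraicClosure F) (δ := δ) hk hkn
  refine ⟨?_, hgen⟩
  obtain ⟨_, S, hS, rfl⟩ := hgen.1
  set E := IntermediateField.adjoin F (Set.range S.toAffine)
  refine ⟨E, ?_, LinSys.ofAffine fun i =>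
    ⟨S.toAffine i, IntermediateField.subset_adjoin F _ ⟨i, rfl⟩⟩, ?_⟩
  · have := (Set.finite_range S.toAffine).to_subtype
    exact IntermediateField.finiteDimensional_adjoin fun x _ => Algebra.IsIntegral.isIntegral x
  · exact LinSys.IsMDP.of_map hk (algebraMap E (AlgebraicClosure F)) hS
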